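/- Let $G$ be a finitely generated free abelian group and $G^\star=\operatorname{Hom}(G,\mathbb Z)$. A convex cone in $G$ is a finitely generated saturated submonoid $M$ of $G$ whose only invertible element is $0$ and such that $G/M^{\mathrm{gp}}$ is torsion free, where $M^{\mathrm{gp}}$ is the subgroup generated by $M$; saturated means that $x\in M^{\mathrm{gp}}$ and $nx\in M$ for some integer $n\ge 1$ imply $x\in M$. A prime ideal of a commutative monoid $P$ is a (possibly empty) subset $\mathfrak p$ with $P+\mathfrak p\subseteq\mathfrak p$ whose complement $P-\mathfrak p$ is a submonoid. A fan in $G$ is a nonempty, possibly infinite, collection $\triangle$ of convex cones in $G$ such that $P-\mathfrak p\in\triangle$ for all $P\in\triangle$ and all prime ideals $\mathfrak p$ of $P$, and such that for all $P,Q\in\triangle$ one has $P\cap Q=P-\mathfrak p=Q-\mathfrak q$ for some prime ideals $\mathfrak p$ of $P$ and $\mathfrak q$ of $Q$. For a commutative ring $R$ and $P\in\triangle$ put $\check P=\{\sigma\in G^\star : \sigma(x)\ge 0\text{ for all }x\in P\}$ and $U_P=\operatorname{Spec}R[\check P]$. For $Q\subseteq P$ in $\triangle$ the inclusion $\check P\subseteq\check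 Q$ induces an open immersion $U_Q\to U_P$, and the toric scheme $X_\triangle(R)$ is obtained by gluing the schemes $U_P$ ($P\in\triangle$) along the open subschemes $U_{P\cap Q}$ of $U_P$ and $U_Q$. Theorem. Let $\triangle$ be a fan in $G$ and $R$ a commutative ring. If $R$ is an integral domain, then $X_\triangle(R)$ is an integral scheme. If $R$ is an integrally closed domain, then $X_\triangle(R)$ is a normal scheme, that is, all its local rings are integrally closed domains. -/

import Mathlib

namespace ToricScheme

open CategoryTheory CategoryTheory.Limits AlgebraicGeometry
open scoped Pointwise

universe u v

section Cones

variable {G : Type v} [AddCommGroup G]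

/-- A *convex cone* in the finitely generated free abelian group `G`: a finitely generated
saturated submonoid `M` of `G` with `M* = {0}` and `G / Mᵍᵖ` torsion free. The subgroup
`AddSubgroup.closure M` of `G` is the group `Mᵍᵖ`, and `M` is saturated if every `x ∈ Mᵍᵖ` with
`n x ∈ M` for some `n ≥ 1` lies in `M`. -/
structure IsConvexCone (M : AddSubmonoid G) : Prop where
  fg : M.FG
  saturated : ∀ x ∈ AddSubgroup.closure (M : Set G), ∀ n : ℕ, 0 < n → n • x ∈ M → x ∈ M
  units_eq_zero : ∀ x ∈ M, -x ∈ M → x = 0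
  torsionFree_quotient : IsAddTorsionFree (G ⧸ AddSubgroup.closure (M : Set G))

/-- An ideal `I` of a commutative (additive) monoid `M`, possibly empty, is *prime* if its
complement is a submonoid of `M`. -/
def IsPrimeIdeal {M : Type*} [AddCommMonoid M] (I : AddSemigroupIdeal M) : Prop :=
  ∃ N : AddSubmonoid M, (N : Set M) = (I : Set M)ᶜ

/-- `Q` is of the form `P - 𝔭` for a prime ideal `𝔭` of the monoid `P`. -/
def IsFace (Q P : AddSubmonoid G) : Prop :=
  ∃ I : AddSemigroupIdeal P, IsPrimeIdeal I ∧ (Q : Set G) = Subtype.val '' (I : Set P)ᶜ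

variable (G) in
/-- A *fan* in `G`: a nonempty (possibly infinite) collection of convex cones in `G` which contains
`P - 𝔭` for all its members `P` and all prime ideals `𝔭` of `P`, and in which the intersection of
two members `P` and `Q` is of the form `P - 𝔭` and of the form `Q - 𝔮`. -/
structure Fan where
  cones : Set (AddSubmonoid G)
  nonempty : cones.Nonempty
  isConvexCone : ∀ P ∈ cones, IsConvexCone P
  face_mem : ∀ P ∈ cones, ∀ Q : AddSubmonoid G, IsFace Q P → Q ∈ cones
  inter_isFace : ∀ P ∈ cones, ∀ Q ∈ cones, IsFace (P ⊓ Q) P ∧ IsFace (P ⊓ Q) Q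

/-- The dual cone `{σ ∈ Hom(G, ℤ) | σ(x) ≥ 0 for all x ∈ P}`. -/
def dualCone (P : AddSubmonoid G) : AddSubmonoid (Module.Dual ℤ G) where
  carrier := {σ | ∀ x ∈ P, 0 ≤ σ x}
  zero_mem' := fun _ _ => le_rfl
  add_mem' := fun hσ hτ x hx => add_nonneg (hσ x hx) (hτ x hx)

theorem dualCone_anti {Q P : AddSubmonoid G} (h : Q ≤ P) : dualCone P ≤ dualCone Q :=
  fun _ hσ x hx => hσ x (h hx)

theorem IsFace.le {Q P : AddSubmonoid G} (h : IsFace Q P) : Q ≤ P := by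
  obtain ⟨I, -, hQ⟩ := h
  intro x hx
  have hx' : x ∈ (Q : Set G) := hx
  rw [hQ] at hx'
  obtain ⟨y, -, rfl⟩ := hx'
  exact y.2

theorem IsFace.mem_of_add_mem {Q P : AddSubmonoid G} (h : IsFace Q P) {x y : G} (hx : x ∈ P)
    (hy : y ∈ P) (hxy : x + y ∈ Q) : y ∈ Q := by
  obtain ⟨I, -, hQ⟩ := h
  have hxy' : x + y ∈ (Q : Set G) := hxy
  rw [hQ] at hxy'
  obtain ⟨z, hz, hzxy⟩ := hxy'
  have hz' : z = ⟨x, hx⟩ + ⟨y, hy⟩ := Subtype.ext hzxy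
  change y ∈ (Q : Set G)
  rw [hQ]
  refine ⟨⟨y, hy⟩, fun hyI => hz ?_, rfl⟩
  rw [hz']
  exact AddSemigroupIdeal.add_mem I _ hyI

/-- Farkas' lemma over the integers. -/
theorem farkas {ι W : Type*} [AddCommGroup W] (s : Finset ι) :
    ∀ (α : ι → W →+ ℤ) (γ : W →+ ℤ), (∀ w, (∀ i ∈ s, 0 ≤ α i w) → 0 ≤ γ w) →
      ∃ N : ℕ, 0 < N ∧ ∃ u : ι → ℕ, ∀ w, (N : ℤ) * γ w = ∑ i ∈ s, (u i : ℤ) * α i w := by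
  classical
  induction s using Finset.induction_on with
  | empty =>
    intro α γ h
    refine ⟨1, one_pos, fun _ => 0, fun w => ?_⟩
    have h1 := h w (by simp)
    have h2 := h (-w) (by simp)
    rw [map_neg] at h2
    simp only [Finset.sum_empty]
    push_cast
    omega
  | insert m s hm ih =>
    intro α γ h
    by_cases hs : ∀ w, (∀ i ∈ s, 0 ≤ α i w) → 0 ≤ γ w
    · obtain ⟨N, hN, u, hu⟩ := ih α γ hs
      refine ⟨N, hN, fun i => if i = m then 0 else u i, fun w => ?_⟩
      rw [hu w, Finset.sum_insert hm]
      simp only [if_true, Nat.cast_zero, zero_mul, zero_add]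
      refine Finset.sum_congr rfl fun i hi => ?_
      rw [if_neg (ne_of_mem_of_not_mem hi hm)]
    · push Not at hs
      obtain ⟨x, hx, hγx⟩ := hs
      have hmx : α m x < 0 := by
        by_contra hc
        push Not at hc
        have := h x (by
          intro i hi
          rcases Finset.mem_insert.1 hi with rfl | hi
          · exact hc
          · exact hx i hi)
        omega
      obtain ⟨c, hc⟩ : ∃ c : ℕ, (c : ℤ) = -α m x := ⟨(-α m x).toNat, by omega⟩
      have hc0 : 0 < c := by omega
      obtain ⟨N, hN, u, hu⟩ := ih (fun i => c • α i + (α i x) • α m) (c • γ + (γ x) • α m) (by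
        intro w hw
        have hy := h (c • w + (α m w) • x) (by
          intro i hi
          rcases Finset.mem_insert.1 hi with rfl | hi
          · simp only [map_add, map_nsmul, map_zsmul, smul_eq_mul, nsmul_eq_mul, hc]
            apply le_of_eq; ring
          · have := hw i hi
            simp only [AddMonoidHom.add_apply, AddMonoidHom.coe_smul, Pi.smul_apply, smul_eq_mul,
              nsmul_eq_mul] at this
            simp only [map_add, map_nsmul, map_zsmul, smul_eq_mul, nsmul_eq_mul]
            linarith)
        simp only [AddMonoidHom.add_apply, AddMonoidHom.coe_smul, Pi.smul_apply, smul_eq_mul,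
          nsmul_eq_mul]
        simp only [map_add, map_nsmul, map_zsmul, smul_eq_mul, nsmul_eq_mul] at hy
        linarith)
      have hd : 0 ≤ ∑ i ∈ s, (u i : ℤ) * α i x - N * γ x := by
        have h1 : 0 ≤ ∑ i ∈ s, (u i : ℤ) * α i x :=
          Finset.sum_nonneg fun i hi => mul_nonneg (by positivity) (hx i hi)
        have h2 : (N : ℤ) * γ x ≤ 0 := mul_nonpos_of_nonneg_of_nonpos (by positivity) hγx.le
        omega
      obtain ⟨d, hd⟩ := Int.eq_ofNat_of_zero_le hd
      refine ⟨N * c, by positivity, fun i => if i = m then d else c * u i, fun w => ?_⟩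
      rw [Finset.sum_insert hm]
      simp only [if_true]
      have h3 : ∑ i ∈ s, (((if i = m then d else c * u i : ℕ)) : ℤ) * α i w =
          ∑ i ∈ s, (c * u i : ℤ) * α i w := by
        refine Finset.sum_congr rfl fun i hi => ?_
        rw [if_neg (ne_of_mem_of_not_mem hi hm)]
        push_cast
        rfl
      rw [h3, ← hd]
      have := hu w
      simp only [AddMonoidHom.add_apply, AddMonoidHom.coe_smul, Pi.smul_apply, smul_eq_mul,
          nsmul_eq_mul] at this
      have h4 : ∑ i ∈ s, (u i : ℤ) * (c * α i w + α i x * α m w) =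
          ∑ i ∈ s, (c * u i : ℤ) * α i w + (∑ i ∈ s, (u i : ℤ) * α i x) * α m w := by
        rw [Finset.sum_mul, ← Finset.sum_add_distrib]
        exact Finset.sum_congr rfl fun i _ => by ring
      rw [h4] at this
      push_cast
      linarith

/-- `σ` is a nonnegative functional on `P` which vanishes exactly on `Q`. -/
def Cuts (σ : Module.Dual ℤ G) (Q P : AddSubmonoid G) : Prop :=
  ∀ x ∈ P, 0 ≤ σ x ∧ (σ x = 0 ↔ x ∈ Q)

theorem Cuts.mem_dualCone {σ : Module.Dual ℤ G} {Q P : AddSubmonoid G} (h : Cuts σ Q P) :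
    σ ∈ dualCone P := fun x hx => (h x hx).1

theorem Cuts.neg_mem_dualCone {σ : Module.Dual ℤ G} {Q P : AddSubmonoid G} (h : Cuts σ Q P)
    (hQP : Q ≤ P) : -σ ∈ dualCone Q := fun x hx => by
  have := (h x (hQP hx)).2.2 hx
  simp [this]

theorem Cuts.exists_nsmul_add_mem {σ : Module.Dual ℤ G} {Q P : AddSubmonoid G} (h : Cuts σ Q P)
    (hP : P.FG) {τ : Module.Dual ℤ G} (hτ : τ ∈ dualCone Q) :
    ∃ n : ℕ, τ + n • σ ∈ dualCone P := by
  obtain ⟨s, rfl⟩ := hP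
  refine ⟨∑ x ∈ s, (τ x).natAbs, fun x hx => ?_⟩
  induction hx using AddSubmonoid.closure_induction with
  | zero => simp
  | add x y hx hy h1 h2 =>
    simp only [map_add]
    exact add_nonneg h1 h2
  | mem x hx =>
    have hx' := AddSubmonoid.subset_closure hx
    obtain ⟨h1, h2⟩ := h x hx'
    simp only [LinearMap.add_apply, LinearMap.smul_apply, nsmul_eq_mul]
    rcases h1.eq_or_lt with h0 | h0
    · have := hτ x (h2.1 h0.symm)
      rw [← h0]
      simpa using this
    · have h3 : (τ x).natAbs ≤ ∑ x ∈ s, (τ x).natAbs :=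
        Finset.single_le_sum (f := fun x => (τ x).natAbs) (fun _ _ => Nat.zero_le _) hx
      have h4 : ((∑ x ∈ s, (τ x).natAbs : ℕ) : ℤ) ≤ ((∑ x ∈ s, (τ x).natAbs : ℕ) : ℤ) * σ x :=
        le_mul_of_one_le_right (by positivity) h0
      generalize (∑ x ∈ s, (τ x).natAbs) = n at *
      omega

theorem Cuts.add {σ τ : Module.Dual ℤ G} {Q Q' P : AddSubmonoid G} (h : Cuts σ Q P)
    (h' : Cuts τ Q' P) : Cuts (σ + τ) (Q ⊓ Q') P := fun x hx => by
  obtain ⟨h1, h2⟩ := h x hx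
  obtain ⟨h3, h4⟩ := h' x hx
  rw [LinearMap.add_apply, AddSubmonoid.mem_inf, ← h2, ← h4]
  omega

theorem IsFace.exists_cuts [Module.Free ℤ G] {Q P : AddSubmonoid G} (h : IsFace Q P)
    (hP : P.FG) : ∃ σ, Cuts σ Q P := by
  classical
  obtain ⟨s, hs⟩ := hP
  have hsP : ∀ x ∈ s, x ∈ P := fun x hx => hs ▸ AddSubmonoid.subset_closure hx
  -- for every generator outside `Q` a functional which is positive on it
  have key : ∀ x ∈ s, ∃ σ : Module.Dual ℤ G, (∀ y ∈ s, 0 ≤ σ y) ∧ (∀ y ∈ s, y ∈ Q → σ y = 0) ∧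
      (x ∉ Q → 0 < σ x) := by
    intro x hx
    by_cases hxQ : x ∈ Q
    · exact ⟨0, by simp, by simp, fun h => absurd hxQ h⟩
    by_contra hcon
    push Not at hcon
    let ev : G → Module.Dual ℤ G →+ ℤ := fun y => (Module.Dual.eval ℤ G y).toAddMonoidHom
    obtain ⟨N, hN, a, ha⟩ := farkas (s.disjSum (s.filter (· ∈ Q)))
      (Sum.elim (fun y => ev y) (fun y => -ev y)) (-ev x) (by
        intro w hw
        have h1 : ∀ y ∈ s, 0 ≤ w y := fun y hy =>
          hw (Sum.inl y) (by simpa using hy)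
        have h2 : ∀ y ∈ s, y ∈ Q → w y = 0 := fun y hy hyQ => by
          have : 0 ≤ -(w y) := hw (Sum.inr y) (by simpa using ⟨hy, hyQ⟩)
          have := h1 y hy
          omega
        have := (hcon w h1 h2).2
        change 0 ≤ -(w x)
        omega)
    have hEq : N • x + ∑ y ∈ s, a (Sum.inl y) • y =
        ∑ y ∈ s.filter (· ∈ Q), a (Sum.inr y) • y := by
      rw [← sub_eq_zero, ← Module.forall_dual_apply_eq_zero_iff ℤ]
      intro w
      have := ha w
      rw [Finset.sum_disjSum] at this
      simp only [Sum.elim_inl, Sum.elim_inr, AddMonoidHom.neg_apply, mul_neg,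
        Finset.sum_neg_distrib] at this
      change -((N : ℤ) * w x) = ∑ y ∈ s, (a (Sum.inl y) : ℤ) * w y +
        -∑ y ∈ s.filter (· ∈ Q), (a (Sum.inr y) : ℤ) * w y at this
      simp only [map_sub, map_add, map_nsmul, map_sum, nsmul_eq_mul]
      linarith
    have hR : ∑ y ∈ s.filter (· ∈ Q), a (Sum.inr y) • y ∈ Q :=
      sum_mem fun y hy => nsmul_mem (Finset.mem_filter.1 hy).2 _
    rw [← hEq] at hR
    have hNx : N • x ∈ Q := by
      rw [add_comm] at hR
      exact h.mem_of_add_mem (sum_mem fun y hy => nsmul_mem (hsP y hy) _)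
        (nsmul_mem (hsP x hx) _) hR
    obtain ⟨N, rfl⟩ := Nat.exists_eq_succ_of_ne_zero hN.ne'
    rw [succ_nsmul] at hNx
    exact hxQ (h.mem_of_add_mem (nsmul_mem (hsP x hx) _) (hsP x hx) hNx)
  choose! f hf1 hf2 hf3 using key
  have hpos : ∀ x ∈ s, 0 ≤ (∑ y ∈ s, f y) x ∧ ((∑ y ∈ s, f y) x = 0 ↔ x ∈ Q) := by
    intro x hx
    rw [LinearMap.sum_apply]
    have h0 : ∀ y ∈ s, 0 ≤ f y x := fun y hy => hf1 y hy x hx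
    refine ⟨Finset.sum_nonneg h0, fun hsum => ?_, fun hxQ =>
      Finset.sum_eq_zero fun y hy => hf2 y hy x hx hxQ⟩
    by_contra hxQ
    have := (Finset.sum_eq_zero_iff_of_nonneg h0).1 hsum x hx
    have := hf3 x hx hxQ
    omega
  refine ⟨∑ y ∈ s, f y, fun x hx => ?_⟩
  rw [← hs] at hx
  induction hx using AddSubmonoid.closure_induction with
  | mem x hx => exact hpos x hx
  | zero => simp
  | add x y hx hy h1 h2 =>
    rw [hs] at hx hy
    rw [map_add]
    refine ⟨add_nonneg h1.1 h2.1, fun h0 => ?_, fun hQ => ?_⟩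
    · exact Q.add_mem (h1.2.1 (by omega)) (h2.2.1 (by omega))
    · have hyQ := h.mem_of_add_mem hx hy hQ
      rw [add_comm] at hQ
      have hxQ := h.mem_of_add_mem hy hx hQ
      rw [h1.2.2 hxQ, h2.2.2 hyQ, add_zero]

end Cones

section Scheme

variable {G : Type v} [AddCommGroup G] (R : Type u) [CommRing R]

/-- The inclusion `R[P^∨] → R[Q^∨]` for `Q ⊆ P`. -/
noncomputable def dualAlgebraMap {Q P : AddSubmonoid G} (h : Q ≤ P) :
    AddMonoidAlgebra R (dualCone P) →+* AddMonoidAlgebra R (dualCone Q) :=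
  AddMonoidAlgebra.mapDomainRingHom R (AddSubmonoid.inclusion (dualCone_anti h))

theorem dualAlgebraMap_isLocalization {Q P : AddSubmonoid G} (h : Q ≤ P) (hP : P.FG)
    {σ : Module.Dual ℤ G} (hσ : Cuts σ Q P) :
    let _ := (dualAlgebraMap R h).toAlgebra
    IsLocalization.Away (AddMonoidAlgebra.single (⟨σ, hσ.mem_dualCone⟩ : dualCone P) (1 : R))
      (AddMonoidAlgebra R (dualCone Q)) := by
  let _ := (dualAlgebraMap R h).toAlgebra
  have hsingle : ∀ (τ : dualCone P) (r : R), algebraMap (AddMonoidAlgebra R (dualCone P))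
      (AddMonoidAlgebra R (dualCone Q)) (AddMonoidAlgebra.single τ r) =
      AddMonoidAlgebra.single (AddSubmonoid.inclusion (dualCone_anti h) τ) r := fun τ r =>
    AddMonoidAlgebra.mapDomain_single
  refine IsLocalization.Away.mk _ ?_ ?_ ?_
  · rw [hsingle]
    refine IsUnit.of_mul_eq_one
      (AddMonoidAlgebra.single (⟨-σ, hσ.neg_mem_dualCone h⟩ : dualCone Q) 1) ?_
    rw [AddMonoidAlgebra.single_mul_single, AddMonoidAlgebra.one_def, one_mul]
    congr 1
    exact Subtype.ext (add_neg_cancel σ)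
  · intro z
    induction z using AddMonoidAlgebra.induction_linear with
    | zero => exact ⟨0, 0, by simp⟩
    | add x y hx hy =>
      obtain ⟨n, a, hn⟩ := hx
      obtain ⟨m, b, hm⟩ := hy
      refine ⟨n + m, a * (AddMonoidAlgebra.single (⟨σ, hσ.mem_dualCone⟩ : dualCone P) (1 : R)) ^ m +
        b * (AddMonoidAlgebra.single (⟨σ, hσ.mem_dualCone⟩ : dualCone P) (1 : R)) ^ n, ?_⟩
      rw [map_add, map_mul, map_mul, map_pow, map_pow, ← hn, ← hm]
      ring
    | single τ r =>
      obtain ⟨n, hn⟩ := hσ.exists_nsmul_add_mem hP τ.2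
      refine ⟨n, AddMonoidAlgebra.single (⟨_, hn⟩ : dualCone P) r, ?_⟩
      rw [hsingle, hsingle, AddMonoidAlgebra.single_pow, AddMonoidAlgebra.single_mul_single,
        one_pow, mul_one]
      rfl
  · intro a b hab
    have hinj : Function.Injective (dualAlgebraMap R h) :=
      AddMonoidAlgebra.mapDomain_injective (AddSubmonoid.inclusion_injective (dualCone_anti h))
    exact ⟨0, by rw [hinj hab]⟩

/-- The affine scheme `U_P = Spec R[P^∨]`. -/
noncomputable abbrev chart (P : AddSubmonoid G) : Scheme.{max u v} :=
  Spec (CommRingCat.of (AddMonoidAlgebra R (dualCone P)))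

/-- The morphism `U_Q ⟶ U_P` for `Q ⊆ P`. -/
noncomputable def chartMap {Q P : AddSubmonoid G} (h : Q ≤ P) : chart R Q ⟶ chart R P :=
  Spec.map (CommRingCat.ofHom (dualAlgebraMap R h))

theorem chartMap_isOpenImmersion {Q P : AddSubmonoid G} (h : Q ≤ P) (hP : P.FG)
    {σ : Module.Dual ℤ G} (hσ : Cuts σ Q P) : IsOpenImmersion (chartMap R h) := by
  let _ := (dualAlgebraMap R h).toAlgebra
  have := dualAlgebraMap_isLocalization R h hP hσ
  exact IsOpenImmersion.of_isLocalization (S := AddMonoidAlgebra R (dualCone Q))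
    (AddMonoidAlgebra.single (⟨σ, hσ.mem_dualCone⟩ : dualCone P) (1 : R))

theorem range_chartMap {Q P : AddSubmonoid G} (h : Q ≤ P) (hP : P.FG)
    {σ : Module.Dual ℤ G} (hσ : Cuts σ Q P) : Set.range (chartMap R h) =
      {x | AddMonoidAlgebra.single (⟨σ, hσ.mem_dualCone⟩ : dualCone P) (1 : R) ∉
        PrimeSpectrum.asIdeal x} := by
  let _ := (dualAlgebraMap R h).toAlgebra
  have := dualAlgebraMap_isLocalization R h hP hσ
  exact PrimeSpectrum.localization_away_comap_range (AddMonoidAlgebra R (dualCone Q))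
    (AddMonoidAlgebra.single (⟨σ, hσ.mem_dualCone⟩ : dualCone P) (1 : R))

variable {R} in
theorem Fan.isFace_of_le (Δ : Fan G) {Q P : AddSubmonoid G} (hQ : Q ∈ Δ.cones) (hP : P ∈ Δ.cones)
    (h : Q ≤ P) : IsFace Q P := by
  have := (Δ.inter_isFace Q hQ P hP).2
  rwa [inf_eq_left.2 h] at this

/-- The diagram of the affine schemes `U_P`, `P ∈ Δ`, and the morphisms `U_Q ⟶ U_P` for `Q ⊆ P`;
the fan is regarded as a partially ordered set by inclusion. -/
noncomputable def chartDiagram (Δ : Fan G) : Δ.cones ⥤ Scheme.{max u v} where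
  obj P := chart R (P : AddSubmonoid G)
  map {Q P} f := chartMap R (show (Q : AddSubmonoid G) ≤ P from leOfHom f)
  map_id P := by
    have : dualAlgebraMap R (le_refl (P : AddSubmonoid G)) = RingHom.id _ :=
      AddMonoidAlgebra.mapDomainRingHom_id
    simp only [chartMap, this]
    exact Spec.map_id _
  map_comp {S Q P} f g := by
    have : dualAlgebraMap R (show (S : AddSubmonoid G) ≤ P from leOfHom (f ≫ g)) =
        (dualAlgebraMap R (show (S : AddSubmonoid G) ≤ Q from leOfHom f)).comp
          (dualAlgebraMap R (show (Q : AddSubmonoid G) ≤ P from leOfHom g)) :=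
      AddMonoidAlgebra.mapDomainRingHom_comp
        (AddSubmonoid.inclusion (dualCone_anti (leOfHom f)))
        (AddSubmonoid.inclusion (dualCone_anti (leOfHom g)))
    simp only [chartMap, this, CommRingCat.ofHom_comp]
    exact Spec.map_comp _ _

variable [Module.Free ℤ G]

instance chartDiagram_isOpenImmersion (Δ : Fan G) {Q P : Δ.cones} (f : Q ⟶ P) :
    IsOpenImmersion ((chartDiagram R Δ).map f) := by
  have hP := (Δ.isConvexCone P P.2).fg
  obtain ⟨σ, hσ⟩ := (Δ.isFace_of_le Q.2 P.2 (leOfHom f)).exists_cuts hP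
  exact chartMap_isOpenImmersion R (leOfHom f) hP hσ

instance chartDiagram_isLocallyDirected (Δ : Fan G) :
    (chartDiagram R Δ ⋙ Scheme.forget).IsLocallyDirected where
  cond {Q Q' P} f f' x x' hxx' := by
    have hP := (Δ.isConvexCone P P.2).fg
    have hQ := Δ.isFace_of_le Q.2 P.2 (leOfHom f)
    have hQ' := Δ.isFace_of_le Q'.2 P.2 (leOfHom f')
    obtain ⟨σ, hσ⟩ := hQ.exists_cuts hP
    obtain ⟨σ', hσ'⟩ := hQ'.exists_cuts hP
    let L : Δ.cones := ⟨(Q : AddSubmonoid G) ⊓ Q',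
      Δ.face_mem Q Q.2 _ (Δ.inter_isFace Q Q.2 Q' Q'.2).1⟩
    let l : L ⟶ Q := homOfLE (show (L : AddSubmonoid G) ≤ Q from inf_le_left)
    let l' : L ⟶ Q' := homOfLE (show (L : AddSubmonoid G) ≤ Q' from inf_le_right)
    have e : (chartDiagram R Δ).map f x = (chartDiagram R Δ).map f' x' := hxx'
    have h1 : (chartDiagram R Δ).map f x ∈ Set.range (chartMap R (leOfHom f)) := ⟨x, rfl⟩
    have h2 : (chartDiagram R Δ).map f x ∈ Set.range (chartMap R (leOfHom f')) :=
      ⟨x', e.symm⟩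
    have h3 : (chartDiagram R Δ).map f x ∈ Set.range (chartMap R (leOfHom (l ≫ f))) := by
      rw [range_chartMap R _ hP hσ] at h1
      rw [range_chartMap R _ hP hσ'] at h2
      rw [range_chartMap R _ hP (hσ.add hσ')]
      intro h
      have : AddMonoidAlgebra.single (⟨σ + σ', (hσ.add hσ').mem_dualCone⟩ :
          dualCone (P : AddSubmonoid G)) (1 : R) =
          AddMonoidAlgebra.single ⟨σ, hσ.mem_dualCone⟩ 1 *
          AddMonoidAlgebra.single ⟨σ', hσ'.mem_dualCone⟩ 1 := by
        rw [AddMonoidAlgebra.single_mul_single, one_mul]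
        rfl
      rw [this] at h
      exact (PrimeSpectrum.isPrime _).mem_or_mem h |>.elim h1 h2
    obtain ⟨y, hy⟩ := h3
    have hy : (chartDiagram R Δ).map (l ≫ f) y = (chartDiagram R Δ).map f x := hy
    refine ⟨L, l, l', y, ?_, ?_⟩
    · apply ((chartDiagram R Δ).map f).isOpenEmbedding.injective
      rw [← hy, Functor.map_comp]
      rfl
    · apply ((chartDiagram R Δ).map f').isOpenEmbedding.injective
      rw [← e, ← hy, show l ≫ f = l' ≫ f' from Subsingleton.elim _ _, Functor.map_comp]
      rfl

/-- The toric scheme `X_Δ(R)`: the affine schemes `U_P`, `P ∈ Δ`, glued along the open subschemes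
`U_{P ∩ Q}` of `U_P` and `U_Q`. As `P ∩ Q` is the largest member of `Δ` contained in `P` and `Q`,
the glued scheme is the colimit of the diagram of all `U_P`, all of whose morphisms are open
immersions. -/
noncomputable def toricScheme (Δ : Fan G) : Scheme.{max u v} :=
  colimit (chartDiagram R Δ)

end Scheme

/-- A scheme is *normal* if all its local rings are integrally closed domains. -/
def IsNormal (X : Scheme.{u}) : Prop :=
  ∀ x : X, IsDomain (X.presheaf.stalk x) ∧ IsIntegrallyClosed (X.presheaf.stalk x)

end ToricScheme

namespace ToricScheme

open CategoryTheory CategoryTheory.Limits AlgebraicGeometry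

universe u v

/-! ### Integral closure in group algebras of lattices -/

section MonoidAlgebra

open LaurentPolynomial

/-! Every chart ring `R[P^∨]` sits inside `R[L]`, `L = Hom(G, ℤ)`, a Laurent polynomial ring in
finitely many variables; over a domain `R` it is therefore a domain. Any two charts `U_P`, `U_Q`
meet, because both receive the nonempty scheme `U_{P ∩ Q}`. Irreducible opens that cover and meet
pairwise have an irreducible union, and reducedness is local, so the toric scheme is integral
(`isIntegral_of_openCover`).

Normality is local and survives localization, so it is enough that `R[P^∨]` is integrally closed
when `R` is. Since `R[L]` is integrally closed, `R[P^∨]` only has to be integrally closed in `R[L]`.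
Now `P^∨` is the intersection of the half-spaces `σ x ≥ 0`, `x ∈ P`, and each can be treated alone
(`nonneg_of_isIntegralElem`): grading `R[L]` by `d σ = σ x` maps it to `R[L][T;T⁻¹]` and `R[P^∨]`
into `R[L][T]`. As `R[L][T]` is integrally closed in `R[L][T;T⁻¹]`, an element integral over
`R[P^∨]` has no term of negative degree. -/

instance isIntegrallyClosed_laurentPolynomial {A : Type*} [CommRing A] [IsDomain A]
    [IsIntegrallyClosed A] : IsIntegrallyClosed A[T;T⁻¹] :=
  isIntegrallyClosed_of_isLocalization A[T;T⁻¹] (Submonoid.powers (Polynomial.X : Polynomial A))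
    (powers_le_nonZeroDivisors_of_noZeroDivisors Polynomial.X_ne_zero)

/-- `A[X]` is integrally closed in `A[T;T⁻¹]`. -/
theorem mem_range_toLaurent_of_isIntegralElem {A : Type*} [CommRing A] [IsDomain A]
    [IsIntegrallyClosed A] {y : A[T;T⁻¹]}
    (hy : (Polynomial.toLaurent (R := A)).IsIntegralElem y) :
    y ∈ (Polynomial.toLaurent (R := A)).range := by
  let K := FractionRing (Polynomial A)
  let ι := algebraMap (Polynomial A) K
  have hι : Function.Injective ι := IsFractionRing.injective _ _
  have hX : IsUnit (ι Polynomial.X) :=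
    isUnit_iff_ne_zero.2 ((map_ne_zero_iff _ hι).2 Polynomial.X_ne_zero)
  let g : A[T;T⁻¹] →+* K := IsLocalization.Away.lift (Polynomial.X : Polynomial A) hX
  have hg (p : Polynomial A) : g (Polynomial.toLaurent p) = ι p :=
    IsLocalization.Away.lift_eq _ hX p
  have hint : IsIntegral (Polynomial A) (g y) := by
    obtain ⟨p, hp, hpy⟩ := hy
    refine ⟨p, hp, ?_⟩
    rw [← map_zero g, ← hpy, Polynomial.hom_eval₂]
    congr 1
    exact RingHom.ext fun a => (hg a).symm
  obtain ⟨p, hp⟩ := IsIntegrallyClosed.isIntegral_iff.1 hint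
  -- Clear denominators: `y * T n` is a polynomial `q`. Comparing in `K` gives `q = p * X ^ n`, and
  -- cancelling the unit `T n` yields `y = p`.
  obtain ⟨n, q, hq⟩ := y.exists_T_pow
  have hpq : q = p * Polynomial.X ^ n := hι <| by
    rw [← hg q, hq, map_mul, ← hp, map_mul, ← hg (Polynomial.X ^ n), Polynomial.toLaurent_X_pow]
  refine ⟨p, (isUnit_T (n : ℤ)).mul_right_cancel ?_⟩
  rw [← hq, hpq, map_mul, Polynomial.toLaurent_X_pow]

theorem isIntegrallyClosed_addMonoidAlgebra_fin (R : Type*) [CommRing R] [IsDomain R]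
    [IsIntegrallyClosed R] (n : ℕ) : IsIntegrallyClosed (AddMonoidAlgebra R (Fin n → ℤ)) := by
  induction n with
  | zero => exact .of_equiv (AddMonoidAlgebra.uniqueRingEquiv (Fin 0 → ℤ)).symm
  | succ n ih =>
    -- Splitting off one coordinate makes `R[ℤⁿ⁺¹]` the Laurent polynomial ring over `R[ℤⁿ]`.
    have : IsIntegrallyClosed (AddMonoidAlgebra (AddMonoidAlgebra R (Fin n → ℤ)) ℤ) :=
      isIntegrallyClosed_laurentPolynomial
    exact .of_equiv ((AddMonoidAlgebra.curryRingEquiv (R := R) (M := ℤ)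
      (N := Fin n → ℤ)).symm.trans (AddMonoidAlgebra.mapDomainRingEquiv R
        (Fin.consLinearEquiv ℤ (fun _ : Fin (n + 1) => ℤ)).toAddEquiv))

variable {L : Type*} [AddCommGroup L] [Module.Free ℤ L] [Module.Finite ℤ L]

theorem isIntegrallyClosed_addMonoidAlgebra (R : Type*) [CommRing R] [IsDomain R]
    [IsIntegrallyClosed R] (L : Type*) [AddCommGroup L] [Module.Free ℤ L] [Module.Finite ℤ L] :
    IsIntegrallyClosed (AddMonoidAlgebra R L) := by
  have := isIntegrallyClosed_addMonoidAlgebra_fin R (Module.finrank ℤ L)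
  exact .of_equiv (AddMonoidAlgebra.mapDomainRingEquiv R
    (Module.finBasis ℤ L).equivFun.toAddEquiv.symm)

/-- Unique sums rule out zero divisors in a monoid algebra over a domain. The property passes from
`ℤⁿ` to `L` and on to its submonoids. -/
theorem uniqueSums_of_free (L : Type*) [AddCommGroup L] [Module.Free ℤ L] [Module.Finite ℤ L] :
    UniqueSums L :=
  .of_injective_addHom (Module.finBasis ℤ L).equivFun.toAddEquiv.toAddMonoidHom.toAddHom
    (Module.finBasis ℤ L).equivFun.injective inferInstance

theorem uniqueSums_addSubmonoid (M : AddSubmonoid L) : UniqueSums M :=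
  .of_injective_addHom M.subtype.toAddHom Subtype.val_injective (uniqueSums_of_free L)

/-- The grading of `R[L]` by a functional `d` on `L`, as a coaction `R[L] → R[L][T;T⁻¹]`. -/
noncomputable def gradingHom (R : Type*) [CommRing R] {L : Type*} [AddCommGroup L] (d : L →+ ℤ) :
    AddMonoidAlgebra R L →+* AddMonoidAlgebra (AddMonoidAlgebra R L) ℤ :=
  (AddMonoidAlgebra.curryRingEquiv (R := R) (M := ℤ) (N := L)).toRingHom.comp
    (AddMonoidAlgebra.mapDomainRingHom R (d.prod (AddMonoidHom.id L)))

theorem gradingHom_single {R : Type*} [CommRing R] {L : Type*} [AddCommGroup L] (d : L →+ ℤ)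
    (σ : L) (r : R) : gradingHom R d (.single σ r) = .single (d σ) (.single σ r) := by
  simp [gradingHom]

/-- The coaction only records degrees and loses no coefficient, so a vanishing degree part bounds
the support of `f`. -/
theorem coeff_gradingHom {R : Type*} [CommRing R] {L : Type*} [AddCommGroup L] (d : L →+ ℤ)
    (σ : L) (f : AddMonoidAlgebra R L) : ((gradingHom R d f).coeff (d σ)).coeff σ = f.coeff σ := by
  classical
  induction f using AddMonoidAlgebra.induction_linear with
  | zero => simp
  | add f g hf hg => simp [hf, hg]
  | single τ r =>
    rw [gradingHom_single, AddMonoidAlgebra.coeff_single]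
    by_cases h : τ = σ
    · simp [h]
    · by_cases h' : d τ = d σ <;> simp [h, h']

theorem mem_range_toLaurent_of_gradingHom {R : Type*} [CommRing R] {L : Type*} [AddCommGroup L]
    {M : AddSubmonoid L} {d : L →+ ℤ} (hd : ∀ σ ∈ M, 0 ≤ d σ) (a : AddMonoidAlgebra R M) :
    gradingHom R d (AddMonoidAlgebra.mapDomainRingHom R M.subtype a) ∈
      (Polynomial.toLaurent (R := AddMonoidAlgebra R L)).range := by
  induction a using AddMonoidAlgebra.induction_linear with
  | zero => simp
  | add f g hf hg => rw [map_add, map_add]; exact add_mem hf hg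
  | single τ r =>
    refine ⟨Polynomial.C (.single (τ : L) r) * Polynomial.X ^ (d τ).toNat, ?_⟩
    rw [Polynomial.toLaurent_C_mul_X_pow, Int.toNat_of_nonneg (hd _ τ.2),
      ← LaurentPolynomial.single_eq_C_mul_T]
    simp [gradingHom_single]

/-- Elements of `R[L]` which are integral over `R[M]` are supported where every functional that is
nonnegative on `M` is nonnegative. -/
theorem nonneg_of_isIntegralElem {R : Type*} [CommRing R] [IsDomain R] [IsIntegrallyClosed R]
    {M : AddSubmonoid L} {d : L →+ ℤ} (hd : ∀ σ ∈ M, 0 ≤ d σ) {f : AddMonoidAlgebra R L}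
    (hf : (AddMonoidAlgebra.mapDomainRingHom R M.subtype).IsIntegralElem f) {σ : L}
    (hσ : f.coeff σ ≠ 0) : 0 ≤ d σ := by
  have := uniqueSums_of_free L
  have := isIntegrallyClosed_addMonoidAlgebra R L
  let A := AddMonoidAlgebra R L
  have hint : (Polynomial.toLaurent (R := A)).IsIntegralElem (gradingHom R d f) := by
    obtain ⟨p, hp, hpf⟩ := hf
    let ψ := (gradingHom R d).comp (AddMonoidAlgebra.mapDomainRingHom R M.subtype)
    -- The coefficients of the integral equation land in `A[X]`, so the equation lifts to a monic
    -- one over `A[X]`.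
    have hψ : p.map ψ ∈ Polynomial.lifts (Polynomial.toLaurent (R := A)) := by
      rw [Polynomial.lifts_iff_coeff_lifts]
      intro n
      rw [Polynomial.coeff_map]
      exact mem_range_toLaurent_of_gradingHom hd _
    obtain ⟨q, hq, -, hqm⟩ := Polynomial.lifts_and_degree_eq_and_monic hψ (hp.map _)
    refine ⟨q, hqm, ?_⟩
    rw [← Polynomial.eval_map, hq, Polynomial.eval_map, ← Polynomial.hom_eval₂, hpf, map_zero]
  obtain ⟨p, hp⟩ := mem_range_toLaurent_of_isIntegralElem hint
  by_contra hneg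
  rw [← coeff_gradingHom d, ← hp, LaurentPolynomial.coeff_toLaurent] at hσ
  refine hσ ?_
  -- A polynomial has coefficient zero in every degree that is not a natural number.
  rw [Finsupp.mapDomain_of_notMem_range]
  · rfl
  · rintro ⟨n, hn⟩
    exact hneg (hn ▸ Int.natCast_nonneg n)

end MonoidAlgebra

/-! ### The coordinate rings of the charts -/

theorem isIntegrallyClosed_dualCone {G : Type*} [AddCommGroup G] [Module.Free ℤ G]
    [Module.Finite ℤ G] (R : Type*) [CommRing R] [IsDomain R] [IsIntegrallyClosed R]
    (P : AddSubmonoid G) : IsIntegrallyClosed (AddMonoidAlgebra R (dualCone P)) := by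
  have := uniqueSums_of_free (Module.Dual ℤ G)
  have := uniqueSums_addSubmonoid (dualCone P)
  have := isIntegrallyClosed_addMonoidAlgebra R (Module.Dual ℤ G)
  let ι := AddMonoidAlgebra.mapDomainRingHom R (dualCone P).subtype
  let := ι.toAlgebra
  have hι : Function.Injective ι := AddMonoidAlgebra.mapDomain_injective Subtype.val_injective
  have : FaithfulSMul (AddMonoidAlgebra R (dualCone P)) (AddMonoidAlgebra R (Module.Dual ℤ G)) :=
    (faithfulSMul_iff_algebraMap_injective _ _).2 hι
  have : IsIntegrallyClosedIn (AddMonoidAlgebra R (dualCone P))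
      (AddMonoidAlgebra R (Module.Dual ℤ G)) := by
    refine isIntegrallyClosedIn_iff.2 ⟨hι, fun {f} hf => ?_⟩
    have hs : (f.coeff.support : Set (Module.Dual ℤ G)) ⊆
        Set.range (Subtype.val : dualCone P → Module.Dual ℤ G) := by
      intro σ hσ
      rw [Subtype.range_coe]
      intro x hx
      -- The functional is evaluation at `x ∈ P`, nonnegative on the dual cone by definition.
      exact nonneg_of_isIntegralElem (M := dualCone P)
        (d := (Module.Dual.eval ℤ G x).toAddMonoidHom) (fun τ hτ => hτ x hx) hf
        (Finsupp.mem_support_iff.1 hσ)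
    exact ⟨_, AddMonoidAlgebra.mapDomain_comapDomain hs Subtype.val_injective⟩
  exact .of_isIntegrallyClosed_of_isIntegrallyClosedIn _ (AddMonoidAlgebra R (Module.Dual ℤ G))

theorem isDomain_dualCone {G : Type*} [AddCommGroup G] [Module.Free ℤ G]
    [Module.Finite ℤ G] (R : Type*) [CommRing R] [IsDomain R] (P : AddSubmonoid G) :
    IsDomain (AddMonoidAlgebra R (dualCone P)) := by
  have := uniqueSums_addSubmonoid (dualCone P)
  infer_instance

/-! ### Normality and integrality from open covers -/

theorem isNormal_Spec (A : CommRingCat.{u}) [IsDomain A] [IsIntegrallyClosed A] :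
    IsNormal (Spec A) := fun x => by
  let p : PrimeSpectrum A := x
  let e : (Spec A).presheaf.stalk x ≃+* Localization.AtPrime p.asIdeal :=
    (Spec.stalkIso A x).commRingCatIsoToRingEquiv
  have : IsDomain (Localization.AtPrime p.asIdeal) := inferInstance
  have : IsIntegrallyClosed (Localization.AtPrime p.asIdeal) :=
    isIntegrallyClosed_of_isLocalization _ p.asIdeal.primeCompl
      p.asIdeal.primeCompl_le_nonZeroDivisors
  exact ⟨e.toMulEquiv.isDomain _, .of_equiv e.symm⟩

theorem IsNormal.of_openCover {X : Scheme.{u}} (𝒰 : X.OpenCover) (h : ∀ i, IsNormal (𝒰.X i)) :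
    IsNormal X := fun x => by
  obtain ⟨i, y, rfl⟩ := 𝒰.exists_eq x
  let e : X.presheaf.stalk (𝒰.f i y) ≃+* (𝒰.X i).presheaf.stalk y :=
    (asIso ((𝒰.f i).stalkMap y)).commRingCatIsoToRingEquiv
  obtain ⟨h₁, h₂⟩ := h i y
  exact ⟨e.toMulEquiv.isDomain _, .of_equiv e.symm⟩

theorem isIntegral_of_openCover {X : Scheme.{u}} (𝒰 : X.OpenCover) [Nonempty 𝒰.I₀]
    [∀ i, AlgebraicGeometry.IsIntegral (𝒰.X i)]
    (h : ∀ i j, (Set.range (𝒰.f i) ∩ Set.range (𝒰.f j)).Nonempty) :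
    AlgebraicGeometry.IsIntegral X := by
  have : IsReduced X := .of_openCover X 𝒰
  have : PreirreducibleSpace X := ⟨fun U V hU hV ⟨x, _, hx⟩ ⟨y, _, hy⟩ => by
    obtain ⟨i, x, rfl⟩ := 𝒰.exists_eq x
    obtain ⟨j, y, rfl⟩ := 𝒰.exists_eq y
    -- An irreducible chart that meets two opens meets their intersection. Applied to chart `i` with
    -- `U` and chart `j`, this makes `U` meet chart `j`; applied to chart `j`, it makes `U` meet
    -- `V`.
    have meets : ∀ {k : 𝒰.I₀} {W W' : Set X}, IsOpen W → IsOpen W' →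
        (Set.range (𝒰.f k) ∩ W).Nonempty → (Set.range (𝒰.f k) ∩ W').Nonempty →
        (Set.range (𝒰.f k) ∩ (W ∩ W')).Nonempty := fun hW hW' h h' =>
      ((PreirreducibleSpace.isPreirreducible_univ.image _
        (𝒰.f _).continuous.continuousOn) _ _ hW hW' (by simpa) (by simpa)).mono (by simp)
    obtain ⟨z, -, hz⟩ := meets hU (𝒰.f j).isOpenEmbedding.isOpen_range ⟨_, ⟨x, rfl⟩, hx⟩ (h i j)
    obtain ⟨w, -, hw⟩ := meets hU hV ⟨z, hz.2, hz.1⟩ ⟨_, ⟨y, rfl⟩, hy⟩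
    exact ⟨w, Set.mem_univ _, hw⟩⟩
  obtain ⟨i⟩ := ‹Nonempty 𝒰.I₀›
  have : IrreducibleSpace X := ⟨⟨𝒰.f i (Nonempty.some inferInstance)⟩⟩
  exact isIntegral_of_irreducibleSpace_of_isReduced X

/-! ### The toric scheme -/

variable {G : Type v} [AddCommGroup G] [Module.Free ℤ G]

/-- The cover of the toric scheme by the charts `U_P`. -/
noncomputable def toricCover (Δ : Fan G) (R : Type u) [CommRing R] :
    (toricScheme R Δ).OpenCover :=
  Scheme.IsLocallyDirected.openCover (chartDiagram R Δ)

theorem isIntegral_toricScheme [Module.Finite ℤ G] (Δ : Fan G) (R : Type u) [CommRing R]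
    [IsDomain R] : AlgebraicGeometry.IsIntegral (toricScheme R Δ) := by
  have hc (P : AddSubmonoid G) : AlgebraicGeometry.IsIntegral (chart R P) := by
    have := isDomain_dualCone R P
    infer_instance
  have : Nonempty (toricCover Δ R).I₀ := Δ.nonempty.to_subtype
  have : ∀ i, AlgebraicGeometry.IsIntegral ((toricCover Δ R).X i) := fun P => hc P.1
  refine isIntegral_of_openCover (toricCover Δ R) fun P Q => ?_
  let S : Δ.cones := ⟨(P.1 : AddSubmonoid G) ⊓ Q.1,
    Δ.face_mem P.1 P.2 _ (Δ.inter_isFace P.1 P.2 Q.1 Q.2).1⟩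
  -- Any point of `U_{P ∩ Q}` maps into both charts, and the colimit identifies its two images.
  let s : (chartDiagram R Δ).obj S := (hc S.1).nonempty.some
  let f : S ⟶ P := homOfLE (show S.1 ≤ P.1 from inf_le_left)
  let g : S ⟶ Q := homOfLE (show S.1 ≤ Q.1 from inf_le_right)
  refine ⟨colimit.ι (chartDiagram R Δ) S s, ⟨(chartDiagram R Δ).map f s, ?_⟩,
    ⟨(chartDiagram R Δ).map g s, ?_⟩⟩
  · exact congr($(colimit.w (chartDiagram R Δ) f) s)
  · exact congr($(colimit.w (chartDiagram R Δ) g) s)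

theorem isNormal_toricScheme [Module.Finite ℤ G] (Δ : Fan G) (R : Type u) [CommRing R]
    [IsDomain R] [IsIntegrallyClosed R] : IsNormal (toricScheme R Δ) :=
  .of_openCover (toricCover Δ R) fun P => by
    have := isDomain_dualCone R P.1
    have := isIntegrallyClosed_dualCone R P.1
    exact isNormal_Spec (CommRingCat.of (AddMonoidAlgebra R (dualCone P.1)))

end ToricScheme

theorem mainTheorem10 {G : Type*} [AddCommGroup G] [Module.Free ℤ G] [Module.Finite ℤ G]
    (Δ : ToricScheme.Fan G) (R : Type*) [CommRing R] :
    (IsDomain R → AlgebraicGeometry.IsIntegral (ToricScheme.toricScheme R Δ)) ∧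
    (IsDomain R → IsIntegrallyClosed R → ToricScheme.IsNormal (ToricScheme.toricScheme R Δ)) :=
  ⟨fun _ => ToricScheme.isIntegral_toricScheme Δ R,
    fun _ _ => ToricScheme.isNormal_toricScheme Δ R⟩
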